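/- A bigraph $G=(V_1,V_2,E)$ consists of disjoint finite sets $V_1,V_2$ and a set $E\subseteq V_1\times V_2$; write $e(G)=|E|$, and let $\rho$ be the bigraph consisting of a single edge. A graphon over a probability space $(X,\mu)$ is a bounded measurable function $W\colon X\times X\to[0,\infty)$ (with respect to the product $\sigma$-algebra) such that $W(x,y)=W(y,x)$ for all $x,y\in X$. Put $$t(G,W)=\int_{X^{V_1}\times X^{V_2}}\prod_{(v,w)\in E}W(x_v,y_w)\,d(\mu^{V_1}\otimes\mu^{V_2})(x,y).$$ The graphon $W$ is regular if $\int_X W(x,y)\,d\mu(y)=t(\rho,W)$ for $\mu$-almost every $x\in X$. The bigraph $G$ is symmetrically Sidorenko if $t(G,W)\ge t(\rho,W)^{e(G)}$ for every graphon $W$ over every probability space. Theorem 8.2. Let $G$ be a bigraph. If there exists a constant $c_G>0$ such that $t(G,W)\ge c_G\cdot t(\rho,W)^{e(G)}$ for every regular graphon $W$ over every probability space, then $G$ is symmetrically Sidorenko. -/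

import Mathlib

open MeasureTheory

universe u v w

/-- A bigraph with (automatically disjoint) finite sides `V₁`, `V₂`: a set of edges
`E ⊆ V₁ × V₂`. The sides may be empty. -/
structure Bigraph (V₁ : Type v) (V₂ : Type w) [Fintype V₁] [Fintype V₂] where
  edges : Finset (V₁ × V₂)

/-- The bigraph `ρ` consisting of a single edge. -/
def Bigraph.rho : Bigraph Unit Unit where
  edges := {((), ())}

/-- The number of edges `e(G)`. -/
def Bigraph.numEdges {V₁ : Type v} {V₂ : Type w} [Fintype V₁] [Fintype V₂]
    (G : Bigraph V₁ V₂) : ℕ :=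
  G.edges.card

/-- A bigraphon: a bounded function `X × Y → ℝ₊`, measurable for the product σ-algebra. -/
structure Bigraphon (X Y : Type u) [MeasurableSpace X] [MeasurableSpace Y] where
  toFun : X → Y → ℝ
  measurable' : Measurable (fun p : X × Y => toFun p.1 p.2)
  nonneg' : ∀ x y, 0 ≤ toFun x y
  bounded' : ∃ C : ℝ, ∀ x y, toFun x y ≤ C

/-- A graphon: a symmetric bigraphon. -/
structure Graphon (X : Type u) [MeasurableSpace X] extends Bigraphon X X where
  symm' : ∀ x y, toFun x y = toFun y x

/-- The density `t(G, W) = ∫_{X^{V₁} × Y^{V₂}} ∏_{(v,w) ∈ E(G)} W(x_v, y_w) d(μ^{V₁} ⊗ ν^{V₂})`. -/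
noncomputable def Bigraph.density {V₁ : Type v} {V₂ : Type w} [Fintype V₁] [Fintype V₂]
    (G : Bigraph V₁ V₂) {X Y : Type u} [MeasurableSpace X] [MeasurableSpace Y]
    (μ : Measure X) (ν : Measure Y) (W : Bigraphon X Y) : ℝ :=
  ∫ p : (V₁ → X) × (V₂ → Y), ∏ e ∈ G.edges, W.toFun (p.1 e.1) (p.2 e.2)
    ∂((Measure.pi fun _ : V₁ => μ).prod (Measure.pi fun _ : V₂ => ν))

/-- A bigraphon is biregular if
`∫ W(x₀, y) dν(y) = ∫ W(x, y₀) dμ(x) = t(ρ, W)` for a.e. `x₀` and a.e. `y₀`. -/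
def Bigraphon.IsBiregular {X Y : Type u} [MeasurableSpace X] [MeasurableSpace Y]
    (W : Bigraphon X Y) (μ : Measure X) (ν : Measure Y) : Prop :=
  (∀ᵐ x₀ ∂μ, ∫ y, W.toFun x₀ y ∂ν = Bigraph.rho.density μ ν W) ∧
    ∀ᵐ y₀ ∂ν, ∫ x, W.toFun x y₀ ∂μ = Bigraph.rho.density μ ν W

/-- A graphon is regular if it is biregular as a bigraphon
(by symmetry the two conditions coincide). -/
def Graphon.IsRegular {X : Type u} [MeasurableSpace X] (W : Graphon X) (μ : Measure X) : Prop :=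
  W.toBigraphon.IsBiregular μ μ

/-- `G` is symmetrically Sidorenko: `t(G, W) ≥ t(ρ, W)^{e(G)}` for every graphon `W` over
every probability space. -/
def Bigraph.IsSymmetricallySidorenko {V₁ : Type v} {V₂ : Type w} [Fintype V₁] [Fintype V₂]
    (G : Bigraph V₁ V₂) : Prop :=
  ∀ (X : Type u) [MeasurableSpace X] (μ : Measure X) [IsProbabilityMeasure μ] (W : Graphon X),
    G.density μ μ W.toBigraphon ≥ Bigraph.rho.density μ μ W.toBigraphon ^ G.numEdges

/-! Write `d` for the edge density of `W` and `e` for the number of edges of `G`. Isolated vertices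
do not affect densities, so every vertex may be assumed to have an edge (`density_core`). Deleting
points of small degree gives a restriction `U ≤ W` with density at least `d / 2` and degrees at
least `d / 4` on its support (`exists_restrict_min_degree`). With `h` the degree of `U` over its
density, `U(x, y) / (h(x) h(y))` is regular over the measure `h μ` and has the density of `U`. Since
`h ≥ 1/4` on the support, this change costs `G` a factor of at most `16 ^ e`
(`density_ge_of_le_degree`). Hence the inequality holds for every graphon of positive density, with
a worse constant. Tensor powers then remove the constant: densities are multiplicative, so its `2 ^
k`-th root may replace it for every `k`. -/

theorem MeasureTheory.measurePreserving_pi_subtype {ι α : Type*} [Fintype ι]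
    [MeasurableSpace α] (p : ι → Prop) [Fintype {i // p i}] (μ : Measure α) [IsProbabilityMeasure μ] :
    MeasurePreserving (fun (f : ι → α) (i : {i // p i}) => f i)
      (Measure.pi fun _ => μ) (Measure.pi fun _ => μ) := by
  classical
  obtain rfl : ‹Fintype {i // p i}› = Subtype.fintype p := Subsingleton.elim _ _
  have h := (measurePreserving_fst (μ := Measure.pi fun _ : {i // p i} => μ)
    (ν := Measure.pi fun _ : {i // ¬ p i} => μ)).comp
    (measurePreserving_piEquivPiSubtypeProd (fun _ : ι => μ) p)
  exact h

/-! ### Integrability of densities and removal of isolated vertices. -/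

namespace Bigraphon

variable {X Y : Type u} [MeasurableSpace X] [MeasurableSpace Y]

theorem measurable_right (W : Bigraphon X Y) (x : X) : Measurable (W.toFun x) :=
  W.measurable'.comp measurable_prodMk_left

theorem integrable_right (W : Bigraphon X Y) (ν : Measure Y) [IsFiniteMeasure ν] (x : X) :
    Integrable (W.toFun x) ν := by
  obtain ⟨C, hC⟩ := W.bounded'
  refine Integrable.of_bound (W.measurable_right x).aestronglyMeasurable C (.of_forall fun y => ?_)
  rw [Real.norm_of_nonneg (W.nonneg' x y)]
  exact hC x y

theorem integrable_prod (W : Bigraphon X Y) (μ : Measure X) (ν : Measure Y) [IsFiniteMeasure μ]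
    [IsFiniteMeasure ν] : Integrable (fun p : X × Y => W.toFun p.1 p.2) (μ.prod ν) := by
  obtain ⟨C, hC⟩ := W.bounded'
  refine Integrable.of_bound W.measurable'.aestronglyMeasurable C (.of_forall fun y => ?_)
  rw [Real.norm_of_nonneg (W.nonneg' _ _)]
  exact hC _ _

theorem density_rho (W : Bigraphon X Y) (μ : Measure X) (ν : Measure Y) [IsProbabilityMeasure μ]
    [IsProbabilityMeasure ν] :
    Bigraph.rho.density μ ν W = ∫ x, ∫ y, W.toFun x y ∂ν ∂μ := by
  rw [← integral_prod (f := fun p : X × Y => W.toFun p.1 p.2) (W.integrable_prod μ ν)]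
  have h := (measurePreserving_funUnique μ Unit).prod (measurePreserving_funUnique ν Unit)
  rw [← h.map_eq, integral_map h.measurable.aemeasurable
    W.measurable'.aestronglyMeasurable]
  simp [Bigraph.density, Bigraph.rho]

end Bigraphon

namespace Bigraph

variable {V₁ : Type v} {V₂ : Type w} [Fintype V₁] [Fintype V₂] (G : Bigraph V₁ V₂)
  {X Y : Type u} [MeasurableSpace X] [MeasurableSpace Y]

theorem measurable_prod_edges (W : Bigraphon X Y) :
    Measurable fun p : (V₁ → X) × (V₂ → Y) => ∏ e ∈ G.edges, W.toFun (p.1 e.1) (p.2 e.2) := by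
  refine Finset.measurable_fun_prod _ fun e _ => ?_
  exact W.measurable'.comp (by fun_prop : Measurable fun p : (V₁ → X) × (V₂ → Y) =>
    (p.1 e.1, p.2 e.2))

theorem prod_edges_nonneg (W : Bigraphon X Y) (p : (V₁ → X) × (V₂ → Y)) :
    0 ≤ ∏ e ∈ G.edges, W.toFun (p.1 e.1) (p.2 e.2) :=
  Finset.prod_nonneg fun _ _ => W.nonneg' _ _

theorem integrable_prod_edges (W : Bigraphon X Y) (M : Measure ((V₁ → X) × (V₂ → Y)))
    [IsFiniteMeasure M] :
    Integrable (fun p => ∏ e ∈ G.edges, W.toFun (p.1 e.1) (p.2 e.2)) M := by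
  obtain ⟨C, hC⟩ := W.bounded'
  refine Integrable.of_bound (G.measurable_prod_edges W).aestronglyMeasurable
    (∏ e ∈ G.edges, C) (.of_forall fun p => ?_)
  rw [Real.norm_of_nonneg (G.prod_edges_nonneg W p)]
  exact Finset.prod_le_prod (fun _ _ => W.nonneg' _ _) fun _ _ => hC _ _

theorem density_nonneg (μ : Measure X) (ν : Measure Y) (W : Bigraphon X Y) :
    0 ≤ G.density μ ν W :=
  integral_nonneg (G.prod_edges_nonneg W)

theorem density_mono (μ : Measure X) (ν : Measure Y) [IsProbabilityMeasure μ]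
    [IsProbabilityMeasure ν] {U W : Bigraphon X Y} (h : ∀ x y, U.toFun x y ≤ W.toFun x y) :
    G.density μ ν U ≤ G.density μ ν W :=
  integral_mono (G.integrable_prod_edges U _) (G.integrable_prod_edges W _) fun _ =>
    Finset.prod_le_prod (fun _ _ => U.nonneg' _ _) fun _ _ => h _ _

open scoped Classical in
/-- The bigraph obtained by deleting the isolated vertices. -/
noncomputable def core :
    Bigraph {v : V₁ // ∃ e ∈ G.edges, e.1 = v} {w : V₂ // ∃ e ∈ G.edges, e.2 = w} where
  edges := G.edges.attach.map
    ⟨fun e => (⟨e.1.1, e.1, e.2, rfl⟩, ⟨e.1.2, e.1, e.2, rfl⟩), fun a b hab => by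
      simp only [Prod.mk.injEq, Subtype.mk.injEq] at hab
      exact Subtype.ext (Prod.ext hab.1 hab.2)⟩

open scoped Classical in
theorem numEdges_core : G.core.numEdges = G.numEdges := by
  simp [core, numEdges]

open scoped Classical in
theorem exists_core_edge_fst (v : {v : V₁ // ∃ e ∈ G.edges, e.1 = v}) :
    ∃ e ∈ G.core.edges, e.1 = v := by
  obtain ⟨_, e, he, rfl⟩ := v
  exact ⟨_, Finset.mem_map_of_mem _ (Finset.mem_attach _ ⟨e, he⟩), rfl⟩

open scoped Classical in
theorem exists_core_edge_snd (v : {v : V₂ // ∃ e ∈ G.edges, e.2 = v}) :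
    ∃ e ∈ G.core.edges, e.2 = v := by
  obtain ⟨_, e, he, rfl⟩ := v
  exact ⟨_, Finset.mem_map_of_mem _ (Finset.mem_attach _ ⟨e, he⟩), rfl⟩

-- The integrand ignores the coordinates of isolated vertices, and these integrate to 1.
open scoped Classical in
theorem density_core (μ : Measure X) (ν : Measure Y) [IsProbabilityMeasure μ]
    [IsProbabilityMeasure ν] (W : Bigraphon X Y) :
    G.core.density μ ν W = G.density μ ν W := by
  have h := (measurePreserving_pi_subtype (fun v : V₁ => ∃ e ∈ G.edges, e.1 = v) μ).prod
    (measurePreserving_pi_subtype (fun v : V₂ => ∃ e ∈ G.edges, e.2 = v) ν)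
  unfold density
  rw [← h.map_eq, integral_map h.measurable.aemeasurable
    (G.core.measurable_prod_edges W).aestronglyMeasurable]
  refine integral_congr_ae (.of_forall fun p => ?_)
  simp only [core, Finset.prod_map, Prod.map]
  exact Finset.prod_attach G.edges fun e => W.toFun (p.1 e.1) (p.2 e.2)

end Bigraph

/-! ### Tensor squares. -/

/-- The tensor square of a graphon. -/
def Graphon.tensorSq {X : Type u} [MeasurableSpace X] (W : Graphon X) : Graphon (X × X) where
  toFun x y := W.toFun x.1 y.1 * W.toFun x.2 y.2
  measurable' := by
    refine Measurable.mul ?_ ?_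
    · exact W.measurable'.comp (by fun_prop : Measurable fun p : (X × X) × (X × X) =>
        (p.1.1, p.2.1))
    · exact W.measurable'.comp (by fun_prop : Measurable fun p : (X × X) × (X × X) =>
        (p.1.2, p.2.2))
  nonneg' x y := mul_nonneg (W.nonneg' _ _) (W.nonneg' _ _)
  bounded' := by
    obtain ⟨C, hC⟩ := W.bounded'
    exact ⟨C * C, fun x y => mul_le_mul (hC _ _) (hC _ _) (W.nonneg' _ _)
      ((W.nonneg' _ _).trans (hC x.1 y.1))⟩
  symm' x y := by rw [W.symm' x.1, W.symm' x.2]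

theorem Bigraph.density_tensorSq {V₁ : Type v} {V₂ : Type w} [Fintype V₁] [Fintype V₂]
    (G : Bigraph V₁ V₂) {X : Type u} [MeasurableSpace X] (μ : Measure X) [IsProbabilityMeasure μ]
    (W : Graphon X) :
    G.density (μ.prod μ) (μ.prod μ) W.tensorSq.toBigraphon =
      G.density μ μ W.toBigraphon ^ 2 := by
  have h₁ := measurePreserving_arrowProdEquivProdArrow X X V₁ (fun _ => μ) (fun _ => μ)
  have h₂ := measurePreserving_arrowProdEquivProdArrow X X V₂ (fun _ => μ) (fun _ => μ)
  set F : (V₁ → X) × (V₂ → X) → ℝ := fun p => ∏ e ∈ G.edges, W.toFun (p.1 e.1) (p.2 e.2) with hF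
  set P₁ := Measure.pi fun _ : V₁ => μ
  set P₂ := Measure.pi fun _ : V₂ => μ
  have hFm : Measurable F := G.measurable_prod_edges W.toBigraphon
  have h := h₁.prod h₂
  have key : ∫ q : ((V₁ → X) × (V₁ → X)) × ((V₂ → X) × (V₂ → X)),
      F (q.1.1, q.2.1) * F (q.1.2, q.2.2) ∂((P₁.prod P₁).prod (P₂.prod P₂)) =
      G.density (μ.prod μ) (μ.prod μ) W.tensorSq.toBigraphon := by
    rw [← h.map_eq, integral_map h.measurable.aemeasurable
      (by fun_prop : Measurable _).aestronglyMeasurable]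
    refine integral_congr_ae (.of_forall fun p => ?_)
    simp only [hF, ← Finset.prod_mul_distrib]
    rfl
  rw [← key, sq]
  have hF' : G.density μ μ W.toBigraphon = ∫ p, F p ∂(P₁.prod P₂) := rfl
  rw [hF', ← integral_prod_mul]
  -- Exchanging the two middle factors regroups the coordinates by copy of `W` instead of by side of
  -- `G`.
  have hs : MeasurePreserving
      (fun q : ((V₁ → X) × (V₁ → X)) × ((V₂ → X) × (V₂ → X)) => ((q.1.1, q.2.1), (q.1.2, q.2.2)))
      ((P₁.prod P₁).prod (P₂.prod P₂)) ((P₁.prod P₂).prod (P₁.prod P₂)) := by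
    have a₁ := measurePreserving_prodAssoc P₁ P₁ (P₂.prod P₂)
    have a₂ := (measurePreserving_prodAssoc P₁ P₂ P₂).symm
    have a₃ := (Measure.measurePreserving_swap (μ := P₁) (ν := P₂)).prod (MeasurePreserving.id P₂)
    have a₄ := measurePreserving_prodAssoc P₂ P₁ P₂
    have a₅ := (measurePreserving_prodAssoc P₁ P₂ (P₁.prod P₂)).symm
    exact a₅.comp (((MeasurePreserving.id P₁).prod (a₄.comp (a₃.comp a₂))).comp a₁)
  rw [← hs.map_eq, integral_map hs.measurable.aemeasurable
      (by fun_prop : Measurable _).aestronglyMeasurable]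

/-! ### Reweighting a graphon to make it regular. -/

open scoped ENNReal in
theorem MeasureTheory.Measure.pi_withDensity_const {ι α : Type*} [Fintype ι] [MeasurableSpace α]
    (μ : Measure α) [IsProbabilityMeasure μ] {h : α → ℝ≥0∞} (hm : Measurable h)
    [IsProbabilityMeasure (μ.withDensity h)] :
    Measure.pi (fun _ : ι => μ.withDensity h) =
      (Measure.pi fun _ : ι => μ).withDensity fun x => ∏ i, h (x i) := by
  refine Measure.pi_eq fun s hs => ?_
  have hs' : MeasurableSet (Set.univ.pi s) := MeasurableSet.univ_pi hs
  rw [withDensity_apply _ hs', ← lintegral_indicator hs']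
  have : ∀ x : ι → α, (Set.univ.pi s).indicator (fun x => ∏ i, h (x i)) x =
      ∏ i, (s i).indicator h (x i) := by
    intro x
    by_cases hx : x ∈ Set.univ.pi s
    · rw [Set.indicator_of_mem hx]
      exact Finset.prod_congr rfl fun i _ => (Set.indicator_of_mem (hx i trivial) h).symm
    · rw [Set.indicator_of_notMem hx]
      obtain ⟨i, hi⟩ : ∃ i, x i ∉ s i := by simpa [Set.mem_pi] using hx
      exact (Finset.prod_eq_zero (Finset.mem_univ i) (Set.indicator_of_notMem hi h)).symm
  simp_rw [this]
  have hmi : ∀ i, Measurable ((s i).indicator h) := fun i => hm.indicator (hs i)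
  rw [ProbabilityTheory.lintegral_prod_eq_prod_lintegral_of_indepFun Finset.univ
    (fun i (x : ι → α) => (s i).indicator h (x i))
    (ProbabilityTheory.iIndepFun_pi (μ := fun _ : ι => μ) (X := fun i => (s i).indicator h)
      fun i => (hmi i).aemeasurable)
    fun i => (hmi i).comp (measurable_pi_apply i)]
  refine Finset.prod_congr rfl fun i _ => ?_
  rw [withDensity_apply _ (hs i), ← lintegral_indicator (hs i)]
  exact (measurePreserving_eval (fun _ : ι => μ) i).lintegral_comp (hmi i)

/-- The degree function of a graphon. -/
noncomputable def Graphon.degree {X : Type u} [MeasurableSpace X] (W : Graphon X) (μ : Measure X)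
    (x : X) : ℝ :=
  ∫ y, W.toFun x y ∂μ

namespace Graphon

variable {X : Type u} [MeasurableSpace X] (W : Graphon X) (μ : Measure X)

theorem degree_nonneg (x : X) : 0 ≤ W.degree μ x :=
  integral_nonneg fun y => W.nonneg' x y

theorem measurable_degree [SFinite μ] : Measurable (W.degree μ) :=
  (W.measurable'.stronglyMeasurable.integral_prod_right (ν := μ)).measurable

theorem integral_degree [IsProbabilityMeasure μ] :
    ∫ x, W.degree μ x ∂μ = Bigraph.rho.density μ μ W.toBigraphon :=
  (W.toBigraphon.density_rho μ μ).symm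

theorem exists_degree_le [IsProbabilityMeasure μ] : ∃ C : ℝ, ∀ x, W.degree μ x ≤ C := by
  obtain ⟨C, hC⟩ := W.bounded'
  refine ⟨C, fun x => ?_⟩
  calc W.degree μ x ≤ ∫ _, C ∂μ :=
        integral_mono (W.integrable_right μ x) (integrable_const C) fun y => hC x y
    _ = C := by simp

theorem integrable_degree [IsProbabilityMeasure μ] : Integrable (W.degree μ) μ := by
  obtain ⟨C, hC⟩ := W.exists_degree_le μ
  refine Integrable.of_bound (W.measurable_degree μ).aestronglyMeasurable C
    (.of_forall fun x => ?_)
  rw [Real.norm_of_nonneg (W.degree_nonneg μ x)]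
  exact hC x

/-- The graphon `W(x, y) / (h(x) h(y))`, where `h` is bounded below on the support of `W`. -/
noncomputable def rescale (h : X → ℝ) (hm : Measurable h) {κ : ℝ} (hκ : 0 < κ) (hh : ∀ x, 0 ≤ h x)
    (hW : ∀ x y, W.toFun x y ≠ 0 → κ ≤ h x) : Graphon X where
  toFun x y := W.toFun x y / (h x * h y)
  measurable' := W.measurable'.div
    ((hm.comp measurable_fst).mul (hm.comp measurable_snd))
  nonneg' x y := div_nonneg (W.nonneg' x y) (mul_nonneg (hh x) (hh y))
  bounded' := by
    obtain ⟨C, hC⟩ := W.bounded'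
    refine ⟨|C| / (κ * κ), fun x y => ?_⟩
    by_cases h0 : W.toFun x y = 0
    · rw [h0, zero_div]; positivity
    · have h1 := hW x y h0
      have h2 := hW y x (W.symm' x y ▸ h0)
      have := (hC x y).trans (le_abs_self C)
      have := hh x
      gcongr
  symm' x y := by rw [W.symm' x y, mul_comm]

end Graphon

namespace Bigraph

variable {V₁ : Type v} {V₂ : Type w} [Fintype V₁] [Fintype V₂] (G : Bigraph V₁ V₂)

/-- If every fibre of `f` over `V` is nonempty and `0 ≤ φ ≤ 1`, the product of `φ ∘ f` is at most
the product of `φ`. -/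
theorem _root_.Finset.prod_comp_le_prod_univ {α V : Type*} [Fintype V] (s : Finset α) (f : α → V)
    (hf : ∀ v, ∃ a ∈ s, f a = v) (φ : V → ℝ) (h0 : ∀ v, 0 ≤ φ v) (h1 : ∀ v, φ v ≤ 1) :
    ∏ a ∈ s, φ (f a) ≤ ∏ v, φ v := by
  classical
  rw [← Finset.prod_fiberwise_of_maps_to (fun a _ => Finset.mem_univ (f a))]
  refine Finset.prod_le_prod (fun v _ => Finset.prod_nonneg fun a _ => h0 _) fun v _ => ?_
  rw [Finset.prod_congr rfl fun a ha => by rw [(Finset.mem_filter.mp ha).2],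
    Finset.prod_const]
  obtain ⟨a, ha, hav⟩ := hf v
  refine pow_le_of_le_one (h0 v) (h1 v) ?_
  exact (Finset.card_pos.mpr ⟨a, Finset.mem_filter.mpr ⟨ha, hav⟩⟩).ne'

/-- The ratios `κ / h` are at most 1 and every vertex lies on an edge, so their product over edges
is at most their product over vertices. There the numerators can be replaced by 1, as `κ ≤ 1`. -/
theorem prod_weights_le {X : Type u} {h : X → ℝ} {κ : ℝ} (hκ : 0 < κ) (hκ1 : κ ≤ 1)
    (hG₁ : ∀ v, ∃ e ∈ G.edges, e.1 = v) (hG₂ : ∀ v, ∃ e ∈ G.edges, e.2 = v)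
    (x : V₁ → X) (y : V₂ → X) (hx : ∀ v, κ ≤ h (x v)) (hy : ∀ v, κ ≤ h (y v)) :
    ((∏ v, h (x v)) * ∏ v, h (y v)) * (κ ^ 2) ^ G.numEdges ≤
      ∏ e ∈ G.edges, (h (x e.1) * h (y e.2)) := by
  have hx0 : ∀ v, 0 < h (x v) := fun v => hκ.trans_le (hx v)
  have hy0 : ∀ v, 0 < h (y v) := fun v => hκ.trans_le (hy v)
  have b₁ : ∏ e ∈ G.edges, κ / h (x e.1) ≤ ∏ v, κ / h (x v) :=
    Finset.prod_comp_le_prod_univ G.edges Prod.fst hG₁ (fun v => κ / h (x v))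
    (fun v => (div_pos hκ (hx0 v)).le) fun v => (div_le_one (hx0 v)).mpr (hx v)
  have b₂ : ∏ e ∈ G.edges, κ / h (y e.2) ≤ ∏ v, κ / h (y v) :=
    Finset.prod_comp_le_prod_univ G.edges Prod.snd hG₂ (fun v => κ / h (y v))
    (fun v => (div_pos hκ (hy0 v)).le) fun v => (div_le_one (hy0 v)).mpr (hy v)
  have c₁ : ∏ v, κ / h (x v) ≤ ∏ v, 1 / h (x v) :=
    Finset.prod_le_prod (fun v _ => (div_pos hκ (hx0 v)).le) fun v _ => by
      have := hx0 v; gcongr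
  have c₂ : ∏ v, κ / h (y v) ≤ ∏ v, 1 / h (y v) :=
    Finset.prod_le_prod (fun v _ => (div_pos hκ (hy0 v)).le) fun v _ => by
      have := hy0 v; gcongr
  have d := mul_le_mul (b₁.trans c₁) (b₂.trans c₂)
    (Finset.prod_nonneg fun e _ => (div_pos hκ (hy0 _)).le)
    (Finset.prod_nonneg fun v _ => (div_pos one_pos (hx0 _)).le)
  rw [Finset.prod_div_distrib, Finset.prod_div_distrib, Finset.prod_div_distrib,
    Finset.prod_div_distrib, Finset.prod_const, Finset.prod_const_one, Finset.prod_const_one,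
    div_mul_div_comm, div_mul_div_comm, ← mul_pow, ← Finset.prod_mul_distrib, one_mul] at d
  have p₁ : 0 < ∏ v, h (x v) := Finset.prod_pos fun v _ => hx0 v
  have p₂ : 0 < ∏ v, h (y v) := Finset.prod_pos fun v _ => hy0 v
  have p₃ : 0 < ∏ e ∈ G.edges, (h (x e.1) * h (y e.2)) :=
    Finset.prod_pos fun e _ => mul_pos (hx0 _) (hy0 _)
  rw [div_le_div_iff₀ p₃ (mul_pos p₁ p₂), one_mul] at d
  rw [sq, numEdges, mul_comm]
  exact d

/-- The weights `1 / h(y)` in the new graphon cancel the density `h(y)` of the new measure, so the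
degree at `x` becomes `U.degree μ x / h x`, a constant. -/
theorem density_ge_of_le_degree {X : Type u} [MeasurableSpace X] (μ : Measure X)
    [IsProbabilityMeasure μ]
    (hG₁ : ∀ v, ∃ e ∈ G.edges, e.1 = v) (hG₂ : ∀ v, ∃ e ∈ G.edges, e.2 = v)
    {c : ℝ} (hG : ∀ (ν : Measure X) [IsProbabilityMeasure ν] (W : Graphon X), W.IsRegular ν →
      c * Bigraph.rho.density ν ν W.toBigraphon ^ G.numEdges ≤ G.density ν ν W.toBigraphon)
    {κ : ℝ} (hκ : 0 < κ) (hκ1 : κ ≤ 1) (U : Graphon X)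
    (hd : 0 < Bigraph.rho.density μ μ U.toBigraphon)
    (hU : ∀ x y, U.toFun x y ≠ 0 → κ * Bigraph.rho.density μ μ U.toBigraphon ≤ U.degree μ x) :
    (κ ^ 2) ^ G.numEdges * (c * Bigraph.rho.density μ μ U.toBigraphon ^ G.numEdges) ≤
      G.density μ μ U.toBigraphon := by
  set d := Bigraph.rho.density μ μ U.toBigraphon with hd_def
  set h : X → ℝ := fun x => U.degree μ x / d with h_def
  have hm : Measurable h := (U.measurable_degree μ).div_const d
  have hh : ∀ x, 0 ≤ h x := fun x => div_nonneg (U.degree_nonneg μ x) hd.le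
  have hUh : ∀ x y, U.toFun x y ≠ 0 → κ ≤ h x := fun x y hxy =>
    (le_div_iff₀ hd).mpr (hU x y hxy)
  set W := U.rescale h hm hκ hh hUh with hW
  have hmE : Measurable fun x => ENNReal.ofReal (h x) := hm.ennreal_ofReal
  set ν := μ.withDensity fun x => ENNReal.ofReal (h x) with hν
  have hint : Integrable h μ := (U.integrable_degree μ).div_const d
  have : IsProbabilityMeasure ν := ⟨by
    rw [hν, withDensity_apply _ MeasurableSet.univ, setLIntegral_univ,
      ← ofReal_integral_eq_lintegral_ofReal hint (.of_forall hh)]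
    simp only [h_def]
    rw [integral_div, U.integral_degree μ, div_self hd.ne', ENNReal.ofReal_one]⟩
  have hdeg : ∀ x, h x ≠ 0 → ∫ y, W.toFun x y ∂ν = d := by
    intro x hx
    rw [hν, integral_withDensity_eq_integral_toReal_smul hmE
      (.of_forall fun _ => ENNReal.ofReal_lt_top)]
    have : ∀ y, (ENNReal.ofReal (h y)).toReal • W.toFun x y = U.toFun x y / h x := by
      intro y
      rw [ENNReal.toReal_ofReal (hh y), smul_eq_mul]
      change h y * (U.toFun x y / (h x * h y)) = _
      by_cases h0 : U.toFun x y = 0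
      · simp [h0]
      · have : h y ≠ 0 := (hκ.trans_le (hUh y x (U.symm' x y ▸ h0))).ne'
        field_simp
    simp_rw [this]
    rw [integral_div]
    have hx' : U.degree μ x ≠ 0 := fun h0 => hx (by simp [h_def, h0])
    change U.degree μ x / (U.degree μ x / d) = d
    field_simp
  have hae : ∀ᵐ x ∂ν, ∫ y, W.toFun x y ∂ν = d := by
    -- The points with `h x = 0` are null for `ν`.
    rw [hν, ae_withDensity_iff hmE]
    refine .of_forall fun x hx => ?_
    refine hdeg x fun h0 => hx ?_
    rw [h0, ENNReal.ofReal_zero]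
  have hrho : Bigraph.rho.density ν ν W.toBigraphon = d := by
    rw [Bigraphon.density_rho, integral_congr_ae hae]
    simp
  have hreg : W.IsRegular ν := by
    refine ⟨by rw [hrho]; exact hae, ?_⟩
    rw [hrho]
    filter_upwards [hae] with y hy
    rw [← hy]
    exact integral_congr_ae (.of_forall fun x => W.symm' x y)
  have key := hG ν W hreg
  rw [hrho] at key
  have hpow : 0 < (κ ^ 2) ^ G.numEdges := by positivity
  refine (mul_le_mul_of_nonneg_left key hpow.le).trans ?_
  unfold density
  rw [hν, Measure.pi_withDensity_const μ hmE, Measure.pi_withDensity_const μ hmE,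
    prod_withDensity (by fun_prop) (by fun_prop),
    integral_withDensity_eq_integral_toReal_smul (by fun_prop)
      (.of_forall fun _ => ENNReal.mul_lt_top (ENNReal.prod_lt_top fun _ _ => ENNReal.ofReal_lt_top)
        (ENNReal.prod_lt_top fun _ _ => ENNReal.ofReal_lt_top)), ← integral_const_mul]
  refine integral_mono_of_nonneg (.of_forall fun p => ?_)
    (G.integrable_prod_edges U.toBigraphon _) (.of_forall fun p => ?_)
  · exact mul_nonneg hpow.le (mul_nonneg ENNReal.toReal_nonneg (G.prod_edges_nonneg _ p))
  · simp only [ENNReal.toReal_mul, ENNReal.toReal_prod, ENNReal.toReal_ofReal (hh _), smul_eq_mul]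
    have hWp : ∏ e ∈ G.edges, W.toFun (p.1 e.1) (p.2 e.2) =
        (∏ e ∈ G.edges, U.toFun (p.1 e.1) (p.2 e.2)) /
          ∏ e ∈ G.edges, (h (p.1 e.1) * h (p.2 e.2)) := by
      rw [← Finset.prod_div_distrib]; rfl
    rw [hWp]
    -- If the product is nonzero, each vertex lies on an edge where `U` is nonzero, so all the
    -- weights are at least `κ`.
    by_cases h0 : ∏ e ∈ G.edges, U.toFun (p.1 e.1) (p.2 e.2) = 0
    · simp [h0]
    have hne : ∀ e ∈ G.edges, U.toFun (p.1 e.1) (p.2 e.2) ≠ 0 := Finset.prod_ne_zero_iff.mp h0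
    have hx : ∀ v, κ ≤ h (p.1 v) := fun v => by
      obtain ⟨e, he, rfl⟩ := hG₁ v
      exact hUh _ _ (hne e he)
    have hy : ∀ v, κ ≤ h (p.2 v) := fun v => by
      obtain ⟨e, he, rfl⟩ := hG₂ v
      exact hUh _ _ (U.symm' _ _ ▸ hne e he)
    have hb := G.prod_weights_le hκ hκ1 hG₁ hG₂ p.1 p.2 hx hy
    have p₃ : 0 < ∏ e ∈ G.edges, (h (p.1 e.1) * h (p.2 e.2)) :=
      Finset.prod_pos fun e _ => mul_pos (hκ.trans_le (hx _)) (hκ.trans_le (hy _))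
    rw [← mul_assoc, mul_div_assoc', div_le_iff₀ p₃, mul_comm]
    refine mul_le_mul_of_nonneg_left ?_ (G.prod_edges_nonneg U.toBigraphon p)
    rw [mul_comm]
    exact hb

end Bigraph

/-! ### Deleting points of small degree. -/

namespace Graphon

variable {X : Type u} [MeasurableSpace X] (W : Graphon X) (μ : Measure X)

/-- The graphon that agrees with `W` on `A × A` and vanishes elsewhere. -/
noncomputable def restrict {A : Set X} (hA : MeasurableSet A) : Graphon X where
  toFun x y := (A ×ˢ A).indicator (fun p : X × X => W.toFun p.1 p.2) (x, y)
  measurable' := W.measurable'.indicator (hA.prod hA)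
  nonneg' x y := Set.indicator_nonneg (fun _ _ => W.nonneg' _ _) _
  bounded' := by
    obtain ⟨C, hC⟩ := W.bounded'
    exact ⟨C, fun x y => (Set.indicator_le_self' (fun _ _ => W.nonneg' _ _) _).trans (hC x y)⟩
  symm' x y := by
    classical
    simp only [Set.indicator_apply, Set.mem_prod, and_comm, W.symm' x y]

theorem restrict_le {A : Set X} (hA : MeasurableSet A) (x y : X) :
    (W.restrict hA).toFun x y ≤ W.toFun x y :=
  Set.indicator_le_self' (f := fun p : X × X => W.toFun p.1 p.2) (fun _ _ => W.nonneg' _ _) (x, y)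

theorem degree_restrict {A : Set X} (hA : MeasurableSet A) {x : X} (hx : x ∈ A) :
    (W.restrict hA).degree μ x = ∫ y in A, W.toFun x y ∂μ := by
  rw [← integral_indicator hA]
  refine integral_congr_ae (.of_forall fun y => ?_)
  classical
  simp [restrict, Set.indicator_apply, hx]

/-- The sets obtained by repeatedly deleting the points of degree less than `τ`. -/
def prune (τ : ℝ) : ℕ → Set X
  | 0 => Set.univ
  | k + 1 => {x ∈ prune τ k | τ ≤ ∫ y in prune τ k, W.toFun x y ∂μ}

theorem prune_succ_subset (τ : ℝ) (k : ℕ) : W.prune μ τ (k + 1) ⊆ W.prune μ τ k :=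
  fun _ hx => hx.1

theorem antitone_prune (τ : ℝ) : Antitone (W.prune μ τ) :=
  antitone_nat_of_succ_le (W.prune_succ_subset μ τ)

variable [IsProbabilityMeasure μ]

theorem measurable_setIntegral (A : Set X) :
    Measurable fun x => ∫ y in A, W.toFun x y ∂μ :=
  W.measurable_degree (μ.restrict A)

theorem measurableSet_prune (τ : ℝ) (k : ℕ) : MeasurableSet (W.prune μ τ k) := by
  induction k with
  | zero => exact MeasurableSet.univ
  | succ k ih =>
    exact ih.inter (measurableSet_le measurable_const (W.measurable_setIntegral μ _))

theorem integrableOn_prod (S : Set (X × X)) :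
    IntegrableOn (fun p : X × X => W.toFun p.1 p.2) S (μ.prod μ) :=
  (W.integrable_prod μ μ).integrableOn

theorem setIntegral_prod_comm (A B : Set X) :
    ∫ p in A ×ˢ B, W.toFun p.1 p.2 ∂μ.prod μ = ∫ p in B ×ˢ A, W.toFun p.1 p.2 ∂μ.prod μ := by
  rw [← setIntegral_prod_swap]
  exact integral_congr_ae (.of_forall fun p => W.symm' _ _)

/-- The lost mass lies over two strips along the deleted set. By symmetry each has at most the mass
of the deleted points against the old set, where their degrees are below `τ`. -/
theorem setIntegral_prune_le (τ : ℝ) (k : ℕ) :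
    ∫ p in W.prune μ τ k ×ˢ W.prune μ τ k, W.toFun p.1 p.2 ∂μ.prod μ ≤
      (∫ p in W.prune μ τ (k + 1) ×ˢ W.prune μ τ (k + 1), W.toFun p.1 p.2 ∂μ.prod μ) +
        2 * τ * (μ.real (W.prune μ τ k) - μ.real (W.prune μ τ (k + 1))) := by
  set A := W.prune μ τ k with hA
  set A' := W.prune μ τ (k + 1) with hA'
  have hAm : MeasurableSet A := W.measurableSet_prune μ τ k
  have hAm' : MeasurableSet A' := W.measurableSet_prune μ τ (k + 1)
  have hsub : A' ⊆ A := W.prune_succ_subset μ τ k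
  have hBm : MeasurableSet (A \ A') := hAm.diff hAm'
  have hAB : A' ∪ A \ A' = A := Set.union_sdiff_cancel hsub
  have hdisj : Disjoint A' (A \ A') := Set.disjoint_sdiff_right
  have split_left : ∫ p in A ×ˢ A, W.toFun p.1 p.2 ∂μ.prod μ =
      (∫ p in A' ×ˢ A, W.toFun p.1 p.2 ∂μ.prod μ) +
        ∫ p in (A \ A') ×ˢ A, W.toFun p.1 p.2 ∂μ.prod μ := by
    rw [← setIntegral_union (Set.disjoint_prod.mpr (.inl hdisj)) (hBm.prod hAm)
      (W.integrableOn_prod μ _) (W.integrableOn_prod μ _), ← Set.union_prod, hAB]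
  have split_right : ∫ p in A' ×ˢ A, W.toFun p.1 p.2 ∂μ.prod μ =
      (∫ p in A' ×ˢ A', W.toFun p.1 p.2 ∂μ.prod μ) +
        ∫ p in A' ×ˢ (A \ A'), W.toFun p.1 p.2 ∂μ.prod μ := by
    rw [← setIntegral_union (Set.disjoint_prod.mpr (.inr hdisj)) (hAm'.prod hBm)
      (W.integrableOn_prod μ _) (W.integrableOn_prod μ _), ← Set.prod_union, hAB]
  have cross : ∫ p in A' ×ˢ (A \ A'), W.toFun p.1 p.2 ∂μ.prod μ ≤
      ∫ p in (A \ A') ×ˢ A, W.toFun p.1 p.2 ∂μ.prod μ := by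
    rw [W.setIntegral_prod_comm μ]
    exact setIntegral_mono_set (W.integrableOn_prod μ _) (.of_forall fun p => W.nonneg' _ _)
      (Set.prod_mono_right hsub).eventuallyLE
  have low : ∫ p in (A \ A') ×ˢ A, W.toFun p.1 p.2 ∂μ.prod μ ≤ τ * μ.real (A \ A') := by
    rw [setIntegral_prod _ (W.integrableOn_prod μ _)]
    have hle : ∀ x ∈ A \ A', ∫ y in A, W.toFun x y ∂μ ≤ τ := fun x hx =>
      (not_le.mp fun h => hx.2 ⟨hx.1, h⟩).le
    calc ∫ x in A \ A', ∫ y in A, W.toFun x y ∂μ ∂μ ≤ ∫ _ in A \ A', τ ∂μ := by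
          refine integral_mono_of_nonneg
            (.of_forall fun x => integral_nonneg fun y => W.nonneg' _ _)
            (integrable_const τ) ?_
          exact (ae_restrict_iff' hBm).mpr (.of_forall hle)
      _ = τ * μ.real (A \ A') := by
          rw [setIntegral_const, smul_eq_mul, mul_comm]
  rw [measureReal_sdiff hsub hAm'] at low
  linarith

/-- The losses telescope, so they total at most `2 * τ` over any number of rounds when `τ ≥ 0`. -/
theorem density_rho_le_prune (τ : ℝ) (k : ℕ) :
    Bigraph.rho.density μ μ W.toBigraphon ≤
      (∫ p in W.prune μ τ k ×ˢ W.prune μ τ k, W.toFun p.1 p.2 ∂μ.prod μ) +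
        2 * τ * (1 - μ.real (W.prune μ τ k)) := by
  induction k with
  | zero =>
    simp only [prune, Set.univ_prod_univ, setIntegral_univ, probReal_univ, sub_self, mul_zero,
      add_zero]
    rw [Bigraphon.density_rho, integral_prod _ (W.integrable_prod μ μ)]
  | succ k ih =>
    have := W.setIntegral_prune_le μ τ k
    linarith

/-- Every graphon contains a restriction with large minimum degree and large edge density. -/
theorem exists_restrict_min_degree {τ : ℝ} (hτ : 0 ≤ τ) :
    ∃ (A : Set X) (hA : MeasurableSet A),
      (∀ x ∈ A, τ ≤ (W.restrict hA).degree μ x) ∧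
      Bigraph.rho.density μ μ W.toBigraphon - 2 * τ ≤
        Bigraph.rho.density μ μ (W.restrict hA).toBigraphon := by
  have hm := W.measurableSet_prune μ τ
  have hanti := W.antitone_prune μ τ
  have hA : MeasurableSet (⋂ k, W.prune μ τ k) := MeasurableSet.iInter hm
  -- A finite round bounds degrees only into the preceding set; in the limit the two sets coincide.
  refine ⟨⋂ k, W.prune μ τ k, hA, fun x hx => ?_, ?_⟩
  · rw [W.degree_restrict μ hA hx]
    have hlim := tendsto_setIntegral_of_antitone (μ := μ) (f := W.toFun x) hm hanti
      ⟨0, (W.integrable_right μ x).integrableOn⟩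
    exact ge_of_tendsto' hlim fun k => (Set.mem_iInter.mp hx (k + 1)).2
  · have hdens : Bigraph.rho.density μ μ (W.restrict hA).toBigraphon =
        ∫ p in (⋂ k, W.prune μ τ k) ×ˢ (⋂ k, W.prune μ τ k), W.toFun p.1 p.2 ∂μ.prod μ := by
      rw [Bigraphon.density_rho, ← integral_indicator (hA.prod hA),
        integral_prod _ ((W.integrable_prod μ μ).indicator (hA.prod hA))]
      rfl
    have hInter : (⋂ k, W.prune μ τ k) ×ˢ (⋂ k, W.prune μ τ k) =
        ⋂ k, W.prune μ τ k ×ˢ W.prune μ τ k := by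
      ext p
      simp only [Set.mem_prod, Set.mem_iInter, forall_and]
    have hlim := tendsto_setIntegral_of_antitone (μ := μ.prod μ)
      (f := fun p : X × X => W.toFun p.1 p.2) (s := fun k => W.prune μ τ k ×ˢ W.prune μ τ k)
      (fun k => (hm k).prod (hm k)) (fun i j hij => Set.prod_mono (hanti hij) (hanti hij))
      ⟨0, W.integrableOn_prod μ _⟩
    rw [hdens, hInter]
    refine ge_of_tendsto' hlim fun k => ?_
    have h1 := W.density_rho_le_prune μ τ k
    have h2 : 0 ≤ τ * μ.real (W.prune μ τ k) := mul_nonneg hτ measureReal_nonneg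
    linarith

end Graphon

/-! ### The inequality with a constant, and its removal by tensor powers. -/

namespace Bigraph

variable {V₁ : Type v} {V₂ : Type w} [Fintype V₁] [Fintype V₂] (G : Bigraph V₁ V₂)

theorem density_ge_of_regular {X : Type u} [MeasurableSpace X] (μ : Measure X)
    [IsProbabilityMeasure μ]
    (hG₁ : ∀ v, ∃ e ∈ G.edges, e.1 = v) (hG₂ : ∀ v, ∃ e ∈ G.edges, e.2 = v)
    {c : ℝ} (hc : 0 ≤ c)
    (hG : ∀ (ν : Measure X) [IsProbabilityMeasure ν] (W : Graphon X), W.IsRegular ν →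
      c * Bigraph.rho.density ν ν W.toBigraphon ^ G.numEdges ≤ G.density ν ν W.toBigraphon)
    (W : Graphon X) (hd : 0 < Bigraph.rho.density μ μ W.toBigraphon) :
    c * (1 / 32) ^ G.numEdges * Bigraph.rho.density μ μ W.toBigraphon ^ G.numEdges ≤
      G.density μ μ W.toBigraphon := by
  set d := Bigraph.rho.density μ μ W.toBigraphon
  -- This threshold costs at most `d / 2` of density. As `U` has density at most `d`, it allows `κ =
  -- 1 / 4`, whence `1 / 32 = (1 / 4) ^ 2 / 2`.
  obtain ⟨A, hA, hdeg, hdens⟩ := W.exists_restrict_min_degree μ (τ := d / 4) (by positivity)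
  set U := W.restrict hA
  have hUW : Bigraph.rho.density μ μ U.toBigraphon ≤ d :=
    Bigraph.rho.density_mono μ μ (W.restrict_le hA)
  have hdU : d / 2 ≤ Bigraph.rho.density μ μ U.toBigraphon := by linarith
  have hmain := G.density_ge_of_le_degree μ hG₁ hG₂ hG (κ := 1 / 4) (by norm_num) (by norm_num) U
    (by linarith) fun x y hxy => by
      have hx : x ∈ A := (Set.mem_of_indicator_ne_zero (s := A ×ˢ A)
        (f := fun p : X × X => W.toFun p.1 p.2) (a := (x, y)) hxy).1
      linarith [hdeg x hx]
  refine (le_trans ?_ hmain).trans (G.density_mono μ μ (W.restrict_le hA))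
  calc c * (1 / 32) ^ G.numEdges * d ^ G.numEdges
      = ((1 / 4) ^ 2) ^ G.numEdges * (c * (d / 2) ^ G.numEdges) := by
        rw [mul_assoc, mul_left_comm _ c, ← mul_pow, ← mul_pow]
        congr 2
        ring
    _ ≤ _ := by gcongr

/-- Each tensor squaring doubles the exponents but leaves `c` unchanged; the induction therefore
ranges over all spaces. -/
theorem pow_two_pow_density_ge {c : ℝ}
    (hG : ∀ (X : Type u) [MeasurableSpace X] (μ : Measure X) [IsProbabilityMeasure μ]
      (W : Graphon X), 0 < Bigraph.rho.density μ μ W.toBigraphon →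
        c * Bigraph.rho.density μ μ W.toBigraphon ^ G.numEdges ≤ G.density μ μ W.toBigraphon)
    (k : ℕ) : ∀ (X : Type u) [MeasurableSpace X] (μ : Measure X) [IsProbabilityMeasure μ]
      (W : Graphon X), 0 < Bigraph.rho.density μ μ W.toBigraphon →
        c * (Bigraph.rho.density μ μ W.toBigraphon ^ G.numEdges) ^ 2 ^ k ≤
          G.density μ μ W.toBigraphon ^ 2 ^ k := by
  induction k with
  | zero => simpa using hG
  | succ k ih =>
    intro X _ μ _ W hd
    have h := ih (X × X) (μ.prod μ) W.tensorSq (by rw [density_tensorSq]; positivity)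
    rw [density_tensorSq, density_tensorSq, pow_right_comm _ 2 G.numEdges] at h
    rw [pow_succ', pow_mul, pow_mul]
    exact h

theorem isSymmetricallySidorenko_of_const_mul_le {c : ℝ} (hc : 0 < c)
    (hG : ∀ (X : Type u) [MeasurableSpace X] (μ : Measure X) [IsProbabilityMeasure μ]
      (W : Graphon X), 0 < Bigraph.rho.density μ μ W.toBigraphon →
        c * Bigraph.rho.density μ μ W.toBigraphon ^ G.numEdges ≤ G.density μ μ W.toBigraphon) :
    IsSymmetricallySidorenko.{u, v, w} G := by
  intro X _ μ _ W
  have ht : 0 ≤ G.density μ μ W.toBigraphon := G.density_nonneg μ μ _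
  rcases (Bigraph.rho.density_nonneg μ μ W.toBigraphon).eq_or_lt with h0 | hd
  · rw [← h0]
    -- For an edgeless `G` both sides are 1, since `0 ^ 0 = 1`.
    by_cases he : G.numEdges = 0
    · have : G.edges = ∅ := Finset.card_eq_zero.mp he
      simp [he, density, this]
    · rw [zero_pow he]
      exact ht
  · by_contra hlt
    rw [ge_iff_le, not_le] at hlt
    set D := Bigraph.rho.density μ μ W.toBigraphon ^ G.numEdges
    have hD : 0 < D := by positivity
    -- A ratio below 1 has powers below `c`, against the lower bound `c` for its `2 ^ n`-th power.
    have hr : G.density μ μ W.toBigraphon / D < 1 := (div_lt_one hD).mpr hlt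
    obtain ⟨n, hn⟩ := exists_pow_lt_of_lt_one hc hr
    have h1 := G.pow_two_pow_density_ge hG n X μ W hd
    rw [← le_div_iff₀ (by positivity), ← div_pow] at h1
    have h2 := pow_le_pow_of_le_one (div_nonneg ht hD.le) hr.le (Nat.lt_two_pow_self (n := n)).le
    linarith

end Bigraph

theorem theorem8p2 {V₁ : Type v} {V₂ : Type w} [Fintype V₁] [Fintype V₂]
    (G : Bigraph V₁ V₂)
    (h : ∃ c : ℝ, 0 < c ∧
      ∀ (X : Type u) [MeasurableSpace X] (μ : Measure X) [IsProbabilityMeasure μ]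
        (W : Graphon X), W.IsRegular μ →
          G.density μ μ W.toBigraphon ≥
            c * Bigraph.rho.density μ μ W.toBigraphon ^ G.numEdges) :
    Bigraph.IsSymmetricallySidorenko.{u, v, w} G := by
  classical
  obtain ⟨c, hc, hG⟩ := h
  refine G.isSymmetricallySidorenko_of_const_mul_le (c := c * (1 / 32) ^ G.numEdges)
    (by positivity) fun X _ μ _ W hd => ?_
  have := G.core.density_ge_of_regular μ G.exists_core_edge_fst G.exists_core_edge_snd hc.le
    (fun ν _ W' hW' => by
      rw [G.density_core, G.numEdges_core]
      exact hG X ν W' hW') W hd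
  rwa [G.density_core, G.numEdges_core] at this
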